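/- **Theorem 8.5 (Strong Maximum Principle).** Let $X$ be a smooth ($C^\infty$) $n$-dimensional riemannian manifold without boundary, let $1\le p\le n$, and let $\mathbb G\subset G(p,TX)$ be a closed subset of the Grassmann bundle of $p$-dimensional subspaces of the tangent spaces of $X$; write $\mathbb G_x$ for its fibre over $x\in X$. Assume: * $\mathbb G$ is *regular*: for every $x_0\in X$, each $W_0\in\mathbb G_{x_0}$ extends to a smooth section $x\mapsto W(x)\in\mathbb G_x$ over some neighbourhood of $x_0$; * $\mathbb G$ *involves all the variables*: for every $x\in X$, the only $v\in T_xX$ with $v\perp W$ for all $W\in\mathbb G_x$ is $v=0$. Let $K\subset X$ be a compact set with $\operatorname{Int}K$ connected and $K=\overline{\operatorname{Int}K}$. Let $u\in \mathrm{PSH}_{\mathbb G}(K)$, i.e. $u:K\to[-\infty,\infty)$ is upper semicontinuous and $u$ is $\mathbb G$-plurisubharmonic on $\operatorname{Int}K$: for every $x\in\operatorname{Int}K$ and every $C^2$ function $\varphi$ defined near $x$ with $u\le\varphi$ near $x$ and $u(x)=\varphi(x)$, one has $\operatorname{tr}_W\operatorname{Hess}_x\varphi\ge 0$ for all $W\in\mathbb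 G_x$, where $\operatorname{Hess}\varphi\,(V,W)=VW\varphi-(\nabla_VW)\varphi$ is the riemannian hessian ($\nabla$ the Levi-Civita connection) and $\operatorname{tr}_W$ is the trace of the restriction to $W$. If there is a point $x_0\in\operatorname{Int}K$ with $u\le u(x_0)$ on $K$, then $u$ is constant on $K$. -/

import Mathlib

open Bundle Manifold Set Filter
open scoped ContDiff Topology

noncomputable section

/-! Riemannian manifold: a smooth manifold `X` modelled on `ℝⁿ`, with inner products on its tangent
spaces (`RiemannianBundle`) depending smoothly on the point (`IsContMDiffRiemannianBundle`). -/

instance {n : ℕ} {X : Type*} [TopologicalSpace X] [ChartedSpace (EuclideanSpace ℝ (Fin n)) X]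
    (x : X) : FiniteDimensional ℝ (TangentSpace (𝓡 n) x) :=
  inferInstanceAs (FiniteDimensional ℝ (EuclideanSpace ℝ (Fin n)))

section RiemannianHessian

variable {n : ℕ} {X : Type*} [TopologicalSpace X] [ChartedSpace (EuclideanSpace ℝ (Fin n)) X]
  [IsManifold (𝓡 n) ∞ X] [RiemannianBundle (fun x : X => TangentSpace (𝓡 n) x)]

/-- The Koszul expression
`V⟨Y,Z⟩ + Y⟨V,Z⟩ - Z⟨V,Y⟩ + ⟨[V,Y],Z⟩ - ⟨[V,Z],Y⟩ - ⟨[Y,Z],V⟩` of three vector fields at `x`,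
which equals `2⟨∇_V Y, Z⟩` for the Levi-Civita connection `∇`. -/
def koszul (V Y Z : ∀ x : X, TangentSpace (𝓡 n) x) (x : X) : ℝ :=
  mvfderiv (𝓡 n) (fun y : X => inner ℝ (Y y) (Z y)) x (V x)
    + mvfderiv (𝓡 n) (fun y : X => inner ℝ (V y) (Z y)) x (Y x)
    - mvfderiv (𝓡 n) (fun y : X => inner ℝ (V y) (Y y)) x (Z x)
    + inner ℝ (VectorField.mlieBracket (𝓡 n) V Y x) (Z x)
    - inner ℝ (VectorField.mlieBracket (𝓡 n) V Z x) (Y x)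
    - inner ℝ (VectorField.mlieBracket (𝓡 n) Y Z x) (V x)

/-- A local extension of a tangent vector to a vector field (smooth near `x`). -/
abbrev extendVec {x : X} (v : TangentSpace (𝓡 n) x) : ∀ y : X, TangentSpace (𝓡 n) y :=
  FiberBundle.extend (EuclideanSpace ℝ (Fin n)) v

/-- The Levi-Civita covariant derivative `∇_v Y` at `x`, for a tangent vector `v` at `x` and a
vector field `Y` differentiable at `x`: the vector whose inner product with every tangent vector
is given by Koszul's formula. -/
def leviCivita (Y : ∀ x : X, TangentSpace (𝓡 n) x) (x : X) (v : TangentSpace (𝓡 n) x) :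
    TangentSpace (𝓡 n) x :=
  ∑ i, ((1 / 2 : ℝ) *
    koszul (extendVec v) Y (extendVec (stdOrthonormalBasis ℝ (TangentSpace (𝓡 n) x) i)) x) •
      stdOrthonormalBasis ℝ (TangentSpace (𝓡 n) x) i

/-- The riemannian hessian `(Hess φ)(v, w) = V(Wφ) - (∇_V W)φ` at `x`, for any vector fields
`V`, `W` extending `v`, `w`. -/
def riemHess (φ : X → ℝ) (x : X) (v w : TangentSpace (𝓡 n) x) : ℝ :=
  mvfderiv (𝓡 n) (fun y : X => mvfderiv (𝓡 n) φ y (extendVec w y)) x v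
    - mvfderiv (𝓡 n) φ x (leviCivita (extendVec w) x v)

end RiemannianHessian

/-- The trace `tr_W A` of (the restriction to `W` of) a bilinear form `A`. -/
def traceOn {V : Type*} [NormedAddCommGroup V] [InnerProductSpace ℝ V] [FiniteDimensional ℝ V]
    (W : Submodule ℝ V) (A : V → V → ℝ) : ℝ :=
  ∑ i, A (stdOrthonormalBasis ℝ W i) (stdOrthonormalBasis ℝ W i)

/-- The set `G(p, V)` of `p`-dimensional linear subspaces of `V`. -/
def Grassmannian (p : ℕ) (V : Type*) [AddCommGroup V] [Module ℝ V] : Type _ :=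
  {W : Submodule ℝ V // Module.finrank ℝ W = p}

section Geometry

variable {n p : ℕ} {X : Type*} [TopologicalSpace X] [ChartedSpace (EuclideanSpace ℝ (Fin n)) X]

variable (n p X) in
/-- The Grassmann bundle `G(p, TX)`: pairs of a point `x` and a `p`-plane in `T_x X`. -/
structure GrassmannBundle where
  /-- the base point -/
  base : X
  /-- the `p`-plane in the tangent space at the base point -/
  plane : Grassmannian p (TangentSpace (𝓡 n) base)

/-- The fibre over `x` of a subset `𝔾` of the Grassmann bundle. -/
def gFiber (𝔾 : Set (GrassmannBundle n p X)) (x : X) :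
    Set (Grassmannian p (TangentSpace (𝓡 n) x)) :=
  {W | (⟨x, W⟩ : GrassmannBundle n p X) ∈ 𝔾}

variable [IsManifold (𝓡 n) ∞ X] [RiemannianBundle (fun x : X => TangentSpace (𝓡 n) x)]

/-- The embedding `W ↦ P_W` (orthogonal projection of `T_x X` onto `W`) of the Grassmann bundle
into the bundle of endomorphisms of the tangent spaces. -/
def planeProj (W : GrassmannBundle n p X) :
    TotalSpace (EuclideanSpace ℝ (Fin n) →L[ℝ] EuclideanSpace ℝ (Fin n))
      (fun x : X => TangentSpace (𝓡 n) x →L[ℝ] TangentSpace (𝓡 n) x) :=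
  ⟨W.base, W.plane.1.starProjection⟩

/-- The topology of the Grassmann bundle, as a subspace of the endomorphism bundle. -/
instance : TopologicalSpace (GrassmannBundle n p X) :=
  TopologicalSpace.induced planeProj inferInstance

/-- `𝔾` is regular: every element `W₀` of `𝔾` over a point `x₀` extends to a smooth section `S` of
`𝔾` over a neighbourhood `U` of `x₀`. The values of `S` outside `U` are irrelevant. -/
def IsRegularPlaneSet (𝔾 : Set (GrassmannBundle n p X)) : Prop :=
  ∀ x₀ : X, ∀ W₀ ∈ gFiber 𝔾 x₀,
    ∃ (U : Set X) (S : ∀ x : X, Grassmannian p (TangentSpace (𝓡 n) x)),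
      IsOpen U ∧ x₀ ∈ U ∧ S x₀ = W₀ ∧ (∀ x ∈ U, S x ∈ gFiber 𝔾 x) ∧
      ContMDiffOn (𝓡 n)
        ((𝓡 n).prod 𝓘(ℝ, EuclideanSpace ℝ (Fin n) →L[ℝ] EuclideanSpace ℝ (Fin n))) ∞
        (fun x : X => planeProj (⟨x, S x⟩ : GrassmannBundle n p X)) U

/-- `𝔾` involves all the variables: at each point, the only tangent vector orthogonal to all
planes of `𝔾` is zero. -/
def InvolvesAllVariables (𝔾 : Set (GrassmannBundle n p X)) : Prop :=
  ∀ (x : X) (v : TangentSpace (𝓡 n) x), (∀ W ∈ gFiber 𝔾 x, v ∈ W.1ᗮ) → v = 0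

/-- `φ` is a test function for `u` at `x`: it is `C²` near `x`, `u ≤ φ` near `x` and
`u x = φ x`. -/
structure IsTestFunction (u : X → EReal) (φ : X → ℝ) (x : X) : Prop where
  contMDiffAt : ContMDiffAt (𝓡 n) 𝓘(ℝ) 2 φ x
  le : ∀ᶠ y in 𝓝 x, u y ≤ (φ y : EReal)
  eq : u x = (φ x : EReal)

/-- `u ∈ PSH_𝔾(K)`: `u` is upper semicontinuous on `K` with values in `[-∞, ∞)`, and it is
`𝔾`-plurisubharmonic in the viscosity sense on the interior of `K`. Only the values of `u` on `K`
matter. -/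
structure IsPSHOn (𝔾 : Set (GrassmannBundle n p X)) (u : X → EReal) (K : Set X) : Prop where
  usc : UpperSemicontinuousOn u K
  lt_top : ∀ x ∈ K, u x < ⊤
  trace_nonneg : ∀ x ∈ interior K, ∀ φ : X → ℝ, IsTestFunction (n := n) u φ x →
    ∀ W ∈ gFiber 𝔾 x, 0 ≤ traceOn W.1 (riemHess φ x)

end Geometry

end

/-!
The maximum principle is Hopf's argument with the barrier `exp (-α ‖x - z‖²)`, carried out in a
chart. Let `M` be the maximum of `u`, and assume it is real. By semicontinuity the set
`{u = M}` is closed in the interior of `K`; the point is that it is open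
(`IsPSHOn.eventually_eq_of_isMaxOn`), after which connectedness gives `u = M` on the interior and
semicontinuity gives it on the closure.

If `{u = M}` were not a neighbourhood of one of its points `q`, some Euclidean ball in the chart at
`q`, with centre `z`, would meet it in a single boundary point `y` (`exists_closedBall_touching`).
Because `𝔾` involves all the variables, some plane of `𝔾` over `y` is not orthogonal to the
direction `y - z`, and by regularity it extends to a continuous field of planes of `𝔾` which are
uniformly non-orthogonal to the radial direction near `y` (`exists_eventually_le_sum_sq`). On these
planes the trace of the Hessian of the barrier is positive once `α` is large: differentiating the
exponential twice gives a term of order `α²` from the radial component, and everything else is of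
order `α` (`riemHess_gaussian_le`). But a small multiple of the barrier, subtracted from a constant,
touches `u` from above at some point near `y` (`exists_touching_perturbation`), and there it is a
test function whose Hessian has negative trace on a plane of `𝔾`, contradicting plurisubharmonicity.

The bound of order `α` needs the Hessian to be locally controlled. For this, Koszul's
formula is computed in a fixed chart (`koszul_eq`), which identifies the Riemannian Hessian with
`D²φ(v, w) - Dφ(Γ(v, w))` (`riemHess_eq`), where `Γ` is built from the first derivatives of the
metric and hence is locally bounded (`exists_eventually_norm_christoffelVec_le`).
-/

/-! ### Tangent vectors, differentials and Lie brackets in a chart -/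

lemma VectorField.mlieBracket_eq_lieBracket {E : Type*} [NormedAddCommGroup E] [NormedSpace ℝ E]
    (V W : ∀ x : E, TangentSpace 𝓘(ℝ, E) x) :
    VectorField.mlieBracket 𝓘(ℝ, E) V W = VectorField.lieBracket ℝ V W := by
  rw [← VectorField.mlieBracketWithin_univ, VectorField.mlieBracketWithin_eq_lieBracketWithin]
  exact VectorField.lieBracketWithin_univ

section Chart

variable {n : ℕ} {X : Type*} [TopologicalSpace X] [ChartedSpace (EuclideanSpace ℝ (Fin n)) X]
  [IsManifold (𝓡 n) ∞ X]

/-- The components of a tangent vector at `x` in the preferred chart at `q`, for `x` in the source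
of that chart; this is the trivialization of the tangent bundle at `q`. -/
noncomputable def tcoord (q x : X) : TangentSpace (𝓡 n) x →L[ℝ] EuclideanSpace ℝ (Fin n) :=
  (trivializationAt (EuclideanSpace ℝ (Fin n)) (TangentSpace (𝓡 n)) q).continuousLinearMapAt ℝ x

/-- The tangent vector at `x` with prescribed components in the preferred chart at `q`. -/
noncomputable def tvec (q x : X) : EuclideanSpace ℝ (Fin n) →L[ℝ] TangentSpace (𝓡 n) x :=
  (trivializationAt (EuclideanSpace ℝ (Fin n)) (TangentSpace (𝓡 n)) q).symmL ℝ x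

variable {q x : X}

lemma tcoord_tvec (hx : x ∈ (chartAt (EuclideanSpace ℝ (Fin n)) q).source)
    (a : EuclideanSpace ℝ (Fin n)) : tcoord q x (tvec q x a) = a :=
  Trivialization.continuousLinearMapAt_symmL _ (by simpa using hx) a

lemma tvec_tcoord (hx : x ∈ (chartAt (EuclideanSpace ℝ (Fin n)) q).source)
    (v : TangentSpace (𝓡 n) x) : tvec q x (tcoord q x v) = v :=
  Trivialization.symmL_continuousLinearMapAt _ (by simpa using hx) v

lemma tcoord_eq_mfderiv (hx : x ∈ (chartAt (EuclideanSpace ℝ (Fin n)) q).source) :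
    tcoord q x = mfderiv (𝓡 n) 𝓘(ℝ, EuclideanSpace ℝ (Fin n)) (extChartAt (𝓡 n) q) x := by
  rw [tcoord, TangentBundle.continuousLinearMapAt_trivializationAt hx]

lemma mdifferentiableAt_extChartAt_symm_apply
    (hx : x ∈ (chartAt (EuclideanSpace ℝ (Fin n)) q).source) :
    MDifferentiableAt 𝓘(ℝ, EuclideanSpace ℝ (Fin n)) (𝓡 n) (extChartAt (𝓡 n) q).symm
      (extChartAt (𝓡 n) q x) := by
  have := mdifferentiableWithinAt_extChartAt_symm (I := 𝓡 n) (x := q)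
    ((extChartAt (𝓡 n) q).map_source (by simpa using hx))
  rwa [ModelWithCorners.Boundaryless.range_eq_univ, mdifferentiableWithinAt_univ] at this

lemma contMDiffAt_extChartAt_symm
    (hx : x ∈ (chartAt (EuclideanSpace ℝ (Fin n)) q).source) :
    ContMDiffAt 𝓘(ℝ, EuclideanSpace ℝ (Fin n)) (𝓡 n) ∞ (extChartAt (𝓡 n) q).symm
      (extChartAt (𝓡 n) q x) := by
  refine (contMDiffOn_extChartAt_symm (I := 𝓡 n) (n := ∞) q).contMDiffAt ?_
  exact (isOpen_extChartAt_target q).mem_nhds ((extChartAt (𝓡 n) q).map_source (by simpa using hx))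

/-- A vector field on `X` read in the preferred chart at `q`, as a map `ℝⁿ → ℝⁿ` (meaningful on the
target of the chart). -/
noncomputable def chartField (q : X) (V : ∀ x : X, TangentSpace (𝓡 n) x) :
    EuclideanSpace ℝ (Fin n) → EuclideanSpace ℝ (Fin n) :=
  fun z => tcoord q _ (V ((extChartAt (𝓡 n) q).symm z))

lemma chartField_extChartAt (hx : x ∈ (chartAt (EuclideanSpace ℝ (Fin n)) q).source)
    (V : ∀ x : X, TangentSpace (𝓡 n) x) :
    chartField q V (extChartAt (𝓡 n) q x) = tcoord q x (V x) := by
  rw [chartField, (extChartAt (𝓡 n) q).left_inv (by simpa using hx)]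

lemma differentiableAt_chartField (hx : x ∈ (chartAt (EuclideanSpace ℝ (Fin n)) q).source)
    {V : ∀ x : X, TangentSpace (𝓡 n) x}
    (hV : MDifferentiableAt (𝓡 n) (𝓡 n).tangent (fun y => (V y : TangentBundle (𝓡 n) X)) x) :
    DifferentiableAt ℝ (chartField q V) (extChartAt (𝓡 n) q x) := by
  have hxs : (extChartAt (𝓡 n) q).symm (extChartAt (𝓡 n) q x) = x :=
    (extChartAt (𝓡 n) q).left_inv (by simpa using hx)
  have h1 := (Trivialization.mdifferentiableAt_section_iff (𝓡 n)
    (trivializationAt (EuclideanSpace ℝ (Fin n)) (TangentSpace (𝓡 n)) q) V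
    (by simpa using hx)).1 hV
  have h2 : MDifferentiableAt (𝓡 n) 𝓘(ℝ, EuclideanSpace ℝ (Fin n))
      (fun y => tcoord q y (V y)) x := by
    refine h1.congr_of_eventuallyEq ?_
    filter_upwards [(chartAt (EuclideanSpace ℝ (Fin n)) q).open_source.mem_nhds hx] with y hy
    exact congrFun (Trivialization.coe_linearMapAt_of_mem
      (trivializationAt (EuclideanSpace ℝ (Fin n)) (TangentSpace (𝓡 n)) q)
      (by simpa using hy)) (V y)
  rw [← mdifferentiableAt_iff_differentiableAt]
  exact MDifferentiableAt.comp (g := fun y => tcoord q y (V y)) _ (by rwa [hxs])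
    (mdifferentiableAt_extChartAt_symm_apply hx)

lemma mdifferentiableAt_extendVec (v : TangentSpace (𝓡 n) x) :
    MDifferentiableAt (𝓡 n) (𝓡 n).tangent (fun y => (extendVec v y : TangentBundle (𝓡 n) X)) x :=
  FiberBundle.mdifferentiableAt_extend (𝓡 n) (EuclideanSpace ℝ (Fin n)) v

lemma extendVec_self (v : TangentSpace (𝓡 n) x) : extendVec v x = v :=
  FiberBundle.extend_apply_self _ v

/-- The differential of a function in coordinates. -/
lemma mvfderiv_eq_fderiv_chart {F : Type*} [NormedAddCommGroup F] [NormedSpace ℝ F] {f : X → F}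
    (hx : x ∈ (chartAt (EuclideanSpace ℝ (Fin n)) q).source)
    (hf : MDifferentiableAt (𝓡 n) 𝓘(ℝ, F) f x) (v : TangentSpace (𝓡 n) x) :
    mvfderiv (𝓡 n) f x v =
      fderiv ℝ (f ∘ (extChartAt (𝓡 n) q).symm) (extChartAt (𝓡 n) q x) (tcoord q x v) := by
  have hxs : (extChartAt (𝓡 n) q).symm (extChartAt (𝓡 n) q x) = x :=
    (extChartAt (𝓡 n) q).left_inv (by simpa using hx)
  have h0 : MDifferentiableAt 𝓘(ℝ, EuclideanSpace ℝ (Fin n)) 𝓘(ℝ, F)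
      (f ∘ (extChartAt (𝓡 n) q).symm) (extChartAt (𝓡 n) q x) :=
    MDifferentiableAt.comp _ (by rwa [hxs]) (mdifferentiableAt_extChartAt_symm_apply hx)
  have h1 : mfderiv (𝓡 n) 𝓘(ℝ, F) f x
      = mfderiv (𝓡 n) 𝓘(ℝ, F) ((f ∘ (extChartAt (𝓡 n) q).symm) ∘ extChartAt (𝓡 n) q) x := by
    apply Filter.EventuallyEq.mfderiv_eq
    filter_upwards [extChartAt_source_mem_nhds' (I := 𝓡 n) (x := q) (x' := x) (by simpa using hx)]
      with y hy
    simp only [Function.comp_apply, (extChartAt (𝓡 n) q).left_inv hy]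
  have h2 : mfderiv (𝓡 n) 𝓘(ℝ, F) ((f ∘ (extChartAt (𝓡 n) q).symm) ∘ extChartAt (𝓡 n) q) x v =
      fderiv ℝ (f ∘ (extChartAt (𝓡 n) q).symm) (extChartAt (𝓡 n) q x) (tcoord q x v) := by
    rw [mfderiv_comp x h0 (mdifferentiableAt_extChartAt hx), ← tcoord_eq_mfderiv hx,
      mfderiv_eq_fderiv]
    rfl
  rw [← h2]
  exact DFunLike.congr_fun h1 v

/-- The Lie bracket in the preferred chart at `q` is `DW(V) - DV(W)`. -/
lemma tcoord_mlieBracket (hx : x ∈ (chartAt (EuclideanSpace ℝ (Fin n)) q).source)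
    {V W : ∀ x : X, TangentSpace (𝓡 n) x}
    (hV : MDifferentiableAt (𝓡 n) (𝓡 n).tangent (fun y => (V y : TangentBundle (𝓡 n) X)) x)
    (hW : MDifferentiableAt (𝓡 n) (𝓡 n).tangent (fun y => (W y : TangentBundle (𝓡 n) X)) x) :
    tcoord q x (VectorField.mlieBracket (𝓡 n) V W x) =
      fderiv ℝ (chartField q W) (extChartAt (𝓡 n) q x)
        (tcoord q x (V x)) -
      fderiv ℝ (chartField q V) (extChartAt (𝓡 n) q x)
        (tcoord q x (W x)) := by
  have hxs : (extChartAt (𝓡 n) q).symm (extChartAt (𝓡 n) q x) = x :=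
    (extChartAt (𝓡 n) q).left_inv (by simpa using hx)
  have : IsManifold (𝓡 n) (minSmoothness ℝ 2) X := by
    rw [minSmoothness_of_isRCLikeNormedField]; exact IsManifold.of_le (n := ∞) (by norm_cast)
  have key := VectorField.mpullback_mlieBracket (I := 𝓘(ℝ, EuclideanSpace ℝ (Fin n)))
    (I' := 𝓡 n) (n := ∞) (f := (extChartAt (𝓡 n) q).symm) (x₀ := extChartAt (𝓡 n) q x)
    (V := V) (W := W) (by rw [hxs]; exact hV) (by rw [hxs]; exact hW)
    (contMDiffAt_extChartAt_symm hx)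
    (by rw [minSmoothness_of_isRCLikeNormedField]; norm_cast)
  have hpb : ∀ (Y : ∀ x : X, TangentSpace (𝓡 n) x), ∀ z ∈ (extChartAt (𝓡 n) q).target,
      VectorField.mpullback 𝓘(ℝ, EuclideanSpace ℝ (Fin n)) (𝓡 n) (extChartAt (𝓡 n) q).symm Y z
        = chartField q Y z := by
    intro Y z hz
    have hzs : (extChartAt (𝓡 n) q).symm z ∈ (chartAt (EuclideanSpace ℝ (Fin n)) q).source := by
      simpa using (extChartAt (𝓡 n) q).map_target hz
    rw [VectorField.mpullback_apply, chartField, tcoord_eq_mfderiv hzs]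
    congr 1
    have h1 := mfderiv_extChartAt_comp_mfderivWithin_extChartAt_symm hz
    have h2 := mfderivWithin_extChartAt_symm_comp_mfderiv_extChartAt hz
    rw [ModelWithCorners.Boundaryless.range_eq_univ, mfderivWithin_univ] at h1 h2
    exact ContinuousLinearMap.inverse_eq h2 h1
  have htarget := (isOpen_extChartAt_target (I := 𝓡 n) q).mem_nhds
    ((extChartAt (𝓡 n) q).map_source (x := x) (by simpa using hx))
  have hev : ∀ (Y : ∀ x : X, TangentSpace (𝓡 n) x),
      VectorField.mpullback 𝓘(ℝ, EuclideanSpace ℝ (Fin n)) (𝓡 n) (extChartAt (𝓡 n) q).symm Y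
        =ᶠ[𝓝 (extChartAt (𝓡 n) q x)] chartField q Y := fun Y =>
    Filter.mem_of_superset htarget fun z hz => hpb Y z hz
  rw [hpb _ _ (mem_of_mem_nhds htarget), (hev V).mlieBracket_vectorField_eq (hev W)] at key
  have h3 := key.trans (congrFun (VectorField.mlieBracket_eq_lieBracket (chartField q V)
    (chartField q W)) _)
  rw [chartField_extChartAt hx] at h3
  rw [h3, VectorField.lieBracket, chartField_extChartAt hx, chartField_extChartAt hx]

end Chart

/-! ### Koszul's formula in a chart -/

lemma ContDiffAt.smul_vector {E F : Type*} [NormedAddCommGroup E] [NormedSpace ℝ E]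
    [NormedAddCommGroup F] [NormedSpace ℝ F] {m : WithTop ℕ∞} {f : E → ℝ} {z : E}
    (hf : ContDiffAt ℝ m f z) (B : F) : ContDiffAt ℝ m (fun z => f z • B) z :=
  hf.fun_smul contDiffAt_const

/-- The case `F = E →L[ℝ] E →L[ℝ] ℝ` of `ContDiffAt.smul_vector`, stated for an abstract `E` so
that the norm and the scalar action on bilinear forms are found by unification. -/
lemma ContDiffAt.smul_bilin {E : Type*} [NormedAddCommGroup E] [NormedSpace ℝ E]
    {m : WithTop ℕ∞} {f : E → ℝ} {z : E} (hf : ContDiffAt ℝ m f z) (B : E →L[ℝ] E →L[ℝ] ℝ) :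
    ContDiffAt ℝ m (fun z => f z • B) z :=
  hf.smul_vector B

section ChartMetric

variable {n : ℕ} {X : Type*} [TopologicalSpace X] [ChartedSpace (EuclideanSpace ℝ (Fin n)) X]
  [IsManifold (𝓡 n) ∞ X]

lemma contMDiffAt_tvec {q x : X} (hx : x ∈ (chartAt (EuclideanSpace ℝ (Fin n)) q).source)
    (a : EuclideanSpace ℝ (Fin n)) :
    ContMDiffAt (𝓡 n) (𝓡 n).tangent ∞ (fun y => (tvec q y a : TangentBundle (𝓡 n) X)) x := by
  refine (Trivialization.contMDiffAt_section_iff (IB := 𝓡 n) (n := ∞)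
    (e := trivializationAt (EuclideanSpace ℝ (Fin n)) (TangentSpace (𝓡 n)) q)
    (s := fun y => tvec q y a) (by simpa using hx)).2 ?_
  refine (contMDiffAt_const (c := a)).congr_of_eventuallyEq ?_
  filter_upwards [(chartAt (EuclideanSpace ℝ (Fin n)) q).open_source.mem_nhds hx] with y hy
  rw [← Trivialization.continuousLinearMapAt_apply_of_mem (R := ℝ)
    (trivializationAt (EuclideanSpace ℝ (Fin n)) (TangentSpace (𝓡 n)) q) (by simpa using hy)]
  exact tcoord_tvec hy a

variable [RiemannianBundle (fun x : X => TangentSpace (𝓡 n) x)]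

/-- The Riemannian metric read in the preferred chart at `q`: the bilinear form
`(a, b) ↦ ∑ gᵢⱼ aᵢ bⱼ`. -/
noncomputable def chartMetric (q : X) (z : EuclideanSpace ℝ (Fin n)) :
    EuclideanSpace ℝ (Fin n) →L[ℝ] EuclideanSpace ℝ (Fin n) →L[ℝ] ℝ :=
  ∑ i, ∑ j, (inner ℝ (tvec q ((extChartAt (𝓡 n) q).symm z) (EuclideanSpace.single i 1))
      (tvec q ((extChartAt (𝓡 n) q).symm z) (EuclideanSpace.single j 1))) •
    (EuclideanSpace.proj i : EuclideanSpace ℝ (Fin n) →L[ℝ] ℝ).smulRight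
      (EuclideanSpace.proj j : EuclideanSpace ℝ (Fin n) →L[ℝ] ℝ)

lemma chartMetric_apply (q : X) (z a b : EuclideanSpace ℝ (Fin n)) :
    chartMetric q z a b = inner ℝ (tvec q ((extChartAt (𝓡 n) q).symm z) a)
      (tvec q ((extChartAt (𝓡 n) q).symm z) b) := by
  have h : ∀ a : EuclideanSpace ℝ (Fin n), a = ∑ i, a i • EuclideanSpace.single i (1 : ℝ) := by
    intro a
    ext j
    simp [Finset.sum_apply, Pi.single_apply]
  conv_rhs => rw [h a, h b]
  simp only [map_sum, map_smul, sum_inner, inner_sum, inner_smul_left, inner_smul_right,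
    chartMetric, _root_.sum_apply, _root_.smul_apply,
    ContinuousLinearMap.smulRight_apply, Finset.mul_sum]
  rw [Finset.sum_comm]
  refine Finset.sum_congr rfl fun i _ => Finset.sum_congr rfl fun j _ => ?_
  simp
  ring

lemma chartMetric_extChartAt {q x : X}
    (hx : x ∈ (chartAt (EuclideanSpace ℝ (Fin n)) q).source) (v w : TangentSpace (𝓡 n) x) :
    chartMetric q (extChartAt (𝓡 n) q x) (tcoord q x v) (tcoord q x w) = inner ℝ v w := by
  rw [chartMetric_apply, (extChartAt (𝓡 n) q).left_inv (by simpa using hx), tvec_tcoord hx,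
    tvec_tcoord hx]

variable [IsContMDiffRiemannianBundle (𝓡 n) ∞ (EuclideanSpace ℝ (Fin n))
      (fun x : X => TangentSpace (𝓡 n) x)]

lemma contDiffOn_chartMetric (q : X) :
    ContDiffOn ℝ ∞ (chartMetric q) (extChartAt (𝓡 n) q).target := by
  intro z hz
  refine ContDiffAt.contDiffWithinAt ?_
  unfold chartMetric
  refine ContDiffAt.sum fun i _ => ContDiffAt.sum fun j _ => ContDiffAt.smul_bilin ?_ _
  have hx : (extChartAt (𝓡 n) q).symm z ∈ (chartAt (EuclideanSpace ℝ (Fin n)) q).source := by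
    simpa using (extChartAt (𝓡 n) q).map_target hz
  rw [← contMDiffAt_iff_contDiffAt]
  have h1 := contMDiffAt_extChartAt_symm hx
  rw [(extChartAt (𝓡 n) q).right_inv hz] at h1
  exact ContMDiffAt.comp (I' := 𝓡 n) z
    (ContMDiffAt.inner_bundle (contMDiffAt_tvec hx _) (contMDiffAt_tvec hx _)) h1

/-- The derivative of the inner product of two vector fields in the preferred chart at `q`. -/
lemma mvfderiv_inner {q x : X} (hx : x ∈ (chartAt (EuclideanSpace ℝ (Fin n)) q).source)
    {V W : ∀ x : X, TangentSpace (𝓡 n) x}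
    (hV : MDifferentiableAt (𝓡 n) (𝓡 n).tangent (fun y => (V y : TangentBundle (𝓡 n) X)) x)
    (hW : MDifferentiableAt (𝓡 n) (𝓡 n).tangent (fun y => (W y : TangentBundle (𝓡 n) X)) x)
    (v : TangentSpace (𝓡 n) x) :
    mvfderiv (𝓡 n) (fun y : X => inner ℝ (V y) (W y)) x v =
      fderiv ℝ (chartMetric q) (extChartAt (𝓡 n) q x) (tcoord q x v) (tcoord q x (V x))
        (tcoord q x (W x)) +
      chartMetric q (extChartAt (𝓡 n) q x)
        (fderiv ℝ (chartField q V) (extChartAt (𝓡 n) q x) (tcoord q x v)) (tcoord q x (W x)) +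
      chartMetric q (extChartAt (𝓡 n) q x) (tcoord q x (V x))
        (fderiv ℝ (chartField q W) (extChartAt (𝓡 n) q x) (tcoord q x v)) := by
  have hz := (extChartAt (𝓡 n) q).map_source (x := x) (by simpa using hx)
  have htarget := (isOpen_extChartAt_target (I := 𝓡 n) q).mem_nhds hz
  have : IsContMDiffRiemannianBundle (𝓡 n) 1 (EuclideanSpace ℝ (Fin n))
      (fun x : X => TangentSpace (𝓡 n) x) :=
    IsContMDiffRiemannianBundle.of_le (n := ∞) (by norm_cast)
  rw [mvfderiv_eq_fderiv_chart hx (MDifferentiableAt.inner_bundle hV hW)]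
  have h1 : (fun y : X => inner ℝ (V y) (W y)) ∘ (extChartAt (𝓡 n) q).symm
      =ᶠ[𝓝 (extChartAt (𝓡 n) q x)]
      fun z => chartMetric q z (chartField q V z) (chartField q W z) := by
    filter_upwards [htarget] with z hz
    have hzs : (extChartAt (𝓡 n) q).symm z ∈ (chartAt (EuclideanSpace ℝ (Fin n)) q).source := by
      simpa using (extChartAt (𝓡 n) q).map_target hz
    rw [Function.comp_apply, ← chartMetric_extChartAt hzs, (extChartAt (𝓡 n) q).right_inv hz]
    rfl
  have hG : DifferentiableAt ℝ (chartMetric q) (extChartAt (𝓡 n) q x) :=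
    ((contDiffOn_chartMetric q).contDiffAt htarget).differentiableAt (by simp)
  have h2 := (hG.hasFDerivAt.clm_apply (differentiableAt_chartField hx hV).hasFDerivAt).clm_apply
    (differentiableAt_chartField hx hW).hasFDerivAt
  rw [h1.fderiv_eq, h2.fderiv]
  simp only [_root_.add_apply, ContinuousLinearMap.comp_apply,
    ContinuousLinearMap.flip_apply, chartField_extChartAt hx]
  ring

/-- Twice the Christoffel symbols of the first kind in the preferred chart at `q`, as a trilinear
expression. -/
noncomputable def christoffelForm (q : X) (z a b c : EuclideanSpace ℝ (Fin n)) : ℝ :=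
  fderiv ℝ (chartMetric q) z a b c + fderiv ℝ (chartMetric q) z b a c
    - fderiv ℝ (chartMetric q) z c a b

/-- Koszul's expression in the preferred chart at `q`. The derivatives of `V` and `Z` cancel, so the
result depends on `V` and `Z` only through their values at `x`. -/
lemma koszul_eq {q x : X} (hx : x ∈ (chartAt (EuclideanSpace ℝ (Fin n)) q).source)
    {V Y Z : ∀ x : X, TangentSpace (𝓡 n) x}
    (hV : MDifferentiableAt (𝓡 n) (𝓡 n).tangent (fun y => (V y : TangentBundle (𝓡 n) X)) x)
    (hY : MDifferentiableAt (𝓡 n) (𝓡 n).tangent (fun y => (Y y : TangentBundle (𝓡 n) X)) x)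
    (hZ : MDifferentiableAt (𝓡 n) (𝓡 n).tangent (fun y => (Z y : TangentBundle (𝓡 n) X)) x) :
    koszul V Y Z x =
      christoffelForm q (extChartAt (𝓡 n) q x) (tcoord q x (V x)) (tcoord q x (Y x))
        (tcoord q x (Z x)) +
      2 * chartMetric q (extChartAt (𝓡 n) q x)
        (fderiv ℝ (chartField q Y) (extChartAt (𝓡 n) q x) (tcoord q x (V x)))
        (tcoord q x (Z x)) := by
  have hsymm : ∀ a b, chartMetric q (extChartAt (𝓡 n) q x) a b =
      chartMetric q (extChartAt (𝓡 n) q x) b a := fun a b => by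
    rw [chartMetric_apply, chartMetric_apply, real_inner_comm]
  rw [koszul, mvfderiv_inner hx hY hZ, mvfderiv_inner hx hV hZ, mvfderiv_inner hx hV hY,
    ← chartMetric_extChartAt hx, ← chartMetric_extChartAt hx, ← chartMetric_extChartAt hx,
    tcoord_mlieBracket hx hV hY, tcoord_mlieBracket hx hV hZ, tcoord_mlieBracket hx hY hZ,
    christoffelForm]
  simp only [map_sub, _root_.sub_apply]
  rw [hsymm (tcoord q x (Y x)), hsymm (tcoord q x (V x)), hsymm (tcoord q x (V x))]
  ring

end ChartMetric

/-! ### The Riemannian Hessian in a chart -/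

lemma ContDiffAt.exists_eventually_norm_fderiv_apply_le {E F : Type*} [NormedAddCommGroup E]
    [NormedSpace ℝ E] [NormedAddCommGroup F] [NormedSpace ℝ F] {G : E → F} {z : E}
    (hG : ContDiffAt ℝ ∞ G z) :
    ∃ C, 0 ≤ C ∧ ∀ᶠ w in 𝓝 z, ∀ a, ‖fderiv ℝ G w a‖ ≤ C * ‖a‖ := by
  have hc : ContinuousAt (fderiv ℝ G) z := (hG.fderiv_right (m := 0) (by simp)).continuousAt
  refine ⟨‖fderiv ℝ G z‖ + 1, by positivity, ?_⟩
  filter_upwards [hc.norm.eventually_lt continuousAt_const (lt_add_one _)] with w hw a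
  exact (ContinuousLinearMap.le_opNorm _ a).trans
    (mul_le_mul_of_nonneg_right hw.le (norm_nonneg a))

lemma ContDiffAt.exists_eventually_abs_fderiv_apply_le {E : Type*} [NormedAddCommGroup E]
    [NormedSpace ℝ E] {G : E → E →L[ℝ] E →L[ℝ] ℝ} {z : E} (hG : ContDiffAt ℝ ∞ G z) :
    ∃ C, 0 ≤ C ∧ ∀ᶠ w in 𝓝 z, ∀ a b c, |fderiv ℝ G w a b c| ≤ C * ‖a‖ * ‖b‖ * ‖c‖ := by
  obtain ⟨C, hC, h⟩ := hG.exists_eventually_norm_fderiv_apply_le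
  refine ⟨C, hC, h.mono fun w hw a b c => ?_⟩
  refine (ContinuousLinearMap.le_opNorm₂ (fderiv ℝ G w a) b c).trans ?_
  gcongr
  exact hw a

section Hessian

variable {n : ℕ} {X : Type*} [TopologicalSpace X] [ChartedSpace (EuclideanSpace ℝ (Fin n)) X]
  [IsManifold (𝓡 n) ∞ X] [RiemannianBundle (fun x : X => TangentSpace (𝓡 n) x)]

/-- The Christoffel correction `Γ(v, w)` at `x`, in the components of the preferred chart at `q`.
The index of the Christoffel symbols of the first kind is raised with an orthonormal basis of the
tangent space instead of the inverse matrix of the metric. -/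
noncomputable def christoffelVec (q x : X) (v w : TangentSpace (𝓡 n) x) :
    EuclideanSpace ℝ (Fin n) :=
  ∑ i, ((1 / 2 : ℝ) * christoffelForm q (extChartAt (𝓡 n) q x) (tcoord q x v) (tcoord q x w)
    (tcoord q x (stdOrthonormalBasis ℝ (TangentSpace (𝓡 n) x) i))) •
      tcoord q x (stdOrthonormalBasis ℝ (TangentSpace (𝓡 n) x) i)

variable [IsContMDiffRiemannianBundle (𝓡 n) ∞ (EuclideanSpace ℝ (Fin n))
      (fun x : X => TangentSpace (𝓡 n) x)]

/-- The Levi-Civita covariant derivative in the preferred chart at `q`: `DY(v) + Γ(v, Y)`. -/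
lemma tcoord_leviCivita {q x : X} (hx : x ∈ (chartAt (EuclideanSpace ℝ (Fin n)) q).source)
    {Y : ∀ x : X, TangentSpace (𝓡 n) x}
    (hY : MDifferentiableAt (𝓡 n) (𝓡 n).tangent (fun y => (Y y : TangentBundle (𝓡 n) X)) x)
    (v : TangentSpace (𝓡 n) x) :
    tcoord q x (leviCivita Y x v) =
      fderiv ℝ (chartField q Y) (extChartAt (𝓡 n) q x) (tcoord q x v)
        + christoffelVec q x v (Y x) := by
  have h1 : ∀ a, ∑ i, (chartMetric q (extChartAt (𝓡 n) q x) a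
      (tcoord q x (stdOrthonormalBasis ℝ (TangentSpace (𝓡 n) x) i))) •
      tcoord q x (stdOrthonormalBasis ℝ (TangentSpace (𝓡 n) x) i) = a := by
    intro a
    conv_rhs => rw [← tcoord_tvec hx a,
      ← (stdOrthonormalBasis ℝ (TangentSpace (𝓡 n) x)).sum_repr (tvec q x a), map_sum]
    refine Finset.sum_congr rfl fun i _ => ?_
    rw [map_smul, OrthonormalBasis.repr_apply_apply, real_inner_comm, ← chartMetric_extChartAt hx,
      tcoord_tvec hx]
  rw [leviCivita, map_sum]
  conv_rhs => rw [← h1 (fderiv ℝ (chartField q Y) (extChartAt (𝓡 n) q x) (tcoord q x v))]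
  rw [christoffelVec, ← Finset.sum_add_distrib]
  refine Finset.sum_congr rfl fun i _ => ?_
  rw [map_smul, koszul_eq hx (mdifferentiableAt_extendVec _) hY (mdifferentiableAt_extendVec _),
    extendVec_self, extendVec_self, ← add_smul]
  congr 1
  ring

/-- The Riemannian Hessian in the preferred chart at `q` is `D²φ(v, w) - Dφ(Γ(v, w))`. The chart is
fixed while `x` varies, whereas the vector fields `extendVec` are built from the chart at `x`. -/
lemma riemHess_eq {q x : X} (hx : x ∈ (chartAt (EuclideanSpace ℝ (Fin n)) q).source)
    {φ : X → ℝ} (hφ : ContMDiffAt (𝓡 n) 𝓘(ℝ) 2 φ x) (v w : TangentSpace (𝓡 n) x) :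
    riemHess φ x v w =
      fderiv ℝ (fderiv ℝ (φ ∘ (extChartAt (𝓡 n) q).symm)) (extChartAt (𝓡 n) q x)
        (tcoord q x v) (tcoord q x w) -
      fderiv ℝ (φ ∘ (extChartAt (𝓡 n) q).symm) (extChartAt (𝓡 n) q x)
        (christoffelVec q x v w) := by
  have hxs : (extChartAt (𝓡 n) q).symm (extChartAt (𝓡 n) q x) = x :=
    (extChartAt (𝓡 n) q).left_inv (by simpa using hx)
  have hφ' : ContDiffAt ℝ 2 (φ ∘ (extChartAt (𝓡 n) q).symm) (extChartAt (𝓡 n) q x) := by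
    rw [← contMDiffAt_iff_contDiffAt]
    exact ContMDiffAt.comp (I' := 𝓡 n) _ (by rwa [hxs])
      ((contMDiffAt_extChartAt_symm hx).of_le (by norm_cast))
  have hd : DifferentiableAt ℝ (fderiv ℝ (φ ∘ (extChartAt (𝓡 n) q).symm))
      (extChartAt (𝓡 n) q x) :=
    (hφ'.fderiv_right (m := 1) (by norm_num)).differentiableAt (by simp)
  have hW := differentiableAt_chartField hx (mdifferentiableAt_extendVec w)
  have hev : ∀ᶠ y in 𝓝 x, mvfderiv (𝓡 n) φ y (extendVec w y) =
      fderiv ℝ (φ ∘ (extChartAt (𝓡 n) q).symm) (extChartAt (𝓡 n) q y)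
        (chartField q (extendVec w) (extChartAt (𝓡 n) q y)) := by
    filter_upwards [(contMDiffAt_iff_contMDiffAt_nhds (by simp)).1 hφ,
      (chartAt (EuclideanSpace ℝ (Fin n)) q).open_source.mem_nhds hx] with y hy hys
    rw [mvfderiv_eq_fderiv_chart hys (hy.mdifferentiableAt two_ne_zero), chartField_extChartAt hys]
  have hdiff : DifferentiableAt ℝ (fun z => fderiv ℝ (φ ∘ (extChartAt (𝓡 n) q).symm) z
      (chartField q (extendVec w) z)) (extChartAt (𝓡 n) q x) := hd.clm_apply hW
  have hmd : MDifferentiableAt (𝓡 n) 𝓘(ℝ) (fun y => mvfderiv (𝓡 n) φ y (extendVec w y)) x := by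
    have h1 := MDifferentiableAt.comp x hdiff.mdifferentiableAt
      (mdifferentiableAt_extChartAt (I := 𝓡 n) hx)
    exact h1.congr_of_eventuallyEq hev
  have hev2 : (fun y => mvfderiv (𝓡 n) φ y (extendVec w y)) ∘ (extChartAt (𝓡 n) q).symm
      =ᶠ[𝓝 (extChartAt (𝓡 n) q x)] fun z => fderiv ℝ (φ ∘ (extChartAt (𝓡 n) q).symm) z
      (chartField q (extendVec w) z) := by
    have hz := (extChartAt (𝓡 n) q).map_source (x := x) (by simpa using hx)
    have hc : Tendsto (extChartAt (𝓡 n) q).symm (𝓝 (extChartAt (𝓡 n) q x)) (𝓝 x) := by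
      have := (mdifferentiableAt_extChartAt_symm_apply hx).continuousAt
      rwa [ContinuousAt, hxs] at this
    filter_upwards [(isOpen_extChartAt_target (I := 𝓡 n) q).mem_nhds hz, hc.eventually hev]
      with z hz h
    rw [Function.comp_apply, h, (extChartAt (𝓡 n) q).right_inv hz]
  rw [riemHess, mvfderiv_eq_fderiv_chart hx hmd, hev2.fderiv_eq,
    (hd.hasFDerivAt.clm_apply hW.hasFDerivAt).fderiv,
    mvfderiv_eq_fderiv_chart hx (hφ.mdifferentiableAt two_ne_zero),
    tcoord_leviCivita hx (mdifferentiableAt_extendVec w), extendVec_self, map_add]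
  simp only [_root_.add_apply, ContinuousLinearMap.comp_apply,
    ContinuousLinearMap.flip_apply, chartField_extChartAt hx, extendVec_self]
  ring

/-- Near `q`, the components of a tangent vector are bounded by its Riemannian norm. -/
lemma exists_eventually_norm_tcoord_le (q : X) :
    ∃ C, 0 < C ∧ ∀ᶠ x in 𝓝 q, ∀ v : TangentSpace (𝓡 n) x, ‖tcoord q x v‖ ≤ C * ‖v‖ := by
  have : IsContinuousRiemannianBundle (EuclideanSpace ℝ (Fin n))
      (fun x : X => TangentSpace (𝓡 n) x) := by
    obtain ⟨g, hg, h⟩ := IsContMDiffRiemannianBundle.exists_contMDiff (IB := 𝓡 n) (n := ∞)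
      (F := EuclideanSpace ℝ (Fin n)) (E := fun x : X => TangentSpace (𝓡 n) x)
    exact ⟨g, hg.continuous, h⟩
  obtain ⟨C₁, hC₁, h₁⟩ := eventually_norm_trivializationAt_lt (EuclideanSpace ℝ (Fin n))
    (fun x : X => TangentSpace (𝓡 n) x) q
  refine ⟨C₁, hC₁, h₁.mono fun x hx v => ?_⟩
  exact ContinuousLinearMap.le_of_opNorm_le _ hx.le v

lemma exists_eventually_abs_christoffelForm_le (q : X) :
    ∃ C, 0 ≤ C ∧ ∀ᶠ x in 𝓝 q, ∀ a b c,
      |christoffelForm q (extChartAt (𝓡 n) q x) a b c| ≤ C * ‖a‖ * ‖b‖ * ‖c‖ := by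
  have hq : extChartAt (𝓡 n) q q ∈ (extChartAt (𝓡 n) q).target := mem_extChartAt_target q
  obtain ⟨C₂, hC₂, h₂⟩ := ContDiffAt.exists_eventually_abs_fderiv_apply_le
    ((contDiffOn_chartMetric q).contDiffAt ((isOpen_extChartAt_target (I := 𝓡 n) q).mem_nhds hq))
  refine ⟨3 * C₂, by positivity, ?_⟩
  filter_upwards [(continuousAt_extChartAt (I := 𝓡 n) q).eventually h₂] with x hx a b c
  have h1 := hx a b c
  have h2 := hx b a c
  have h3 := hx c a b
  rw [christoffelForm]
  refine (abs_sub _ _).trans ((add_le_add (abs_add_le _ _) le_rfl).trans ?_)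
  calc _ ≤ C₂ * ‖a‖ * ‖b‖ * ‖c‖ + C₂ * ‖b‖ * ‖a‖ * ‖c‖ + C₂ * ‖c‖ * ‖a‖ * ‖b‖ :=
        add_le_add (add_le_add h1 h2) h3
    _ = _ := by ring

/-- Near `q`, the Christoffel correction is bounded by the square of the Riemannian norm. -/
lemma exists_eventually_norm_christoffelVec_le (q : X) :
    ∃ C, 0 < C ∧ ∀ᶠ x in 𝓝 q, ∀ v : TangentSpace (𝓡 n) x,
      ‖christoffelVec q x v v‖ ≤ C * ‖v‖ ^ 2 := by
  obtain ⟨C₁, hC₁, h₁⟩ := exists_eventually_norm_tcoord_le (n := n) q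
  obtain ⟨C₂, hC₂, h₂⟩ := exists_eventually_abs_christoffelForm_le (n := n) q
  refine ⟨n * ((1 / 2) * (C₂ * C₁ ^ 4)) + 1, by positivity, ?_⟩
  filter_upwards [h₁, h₂] with x hb hform v
  have hterm : ∀ i, ‖((1 / 2 : ℝ) * christoffelForm q (extChartAt (𝓡 n) q x) (tcoord q x v)
      (tcoord q x v) (tcoord q x (stdOrthonormalBasis ℝ (TangentSpace (𝓡 n) x) i))) •
      tcoord q x (stdOrthonormalBasis ℝ (TangentSpace (𝓡 n) x) i)‖
      ≤ (1 / 2) * (C₂ * C₁ ^ 4) * ‖v‖ ^ 2 := by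
    intro i
    have he := hb (stdOrthonormalBasis ℝ (TangentSpace (𝓡 n) x) i)
    rw [OrthonormalBasis.norm_eq_one, mul_one] at he
    have hv := hb v
    have hf := hform (tcoord q x v) (tcoord q x v)
      (tcoord q x (stdOrthonormalBasis ℝ (TangentSpace (𝓡 n) x) i))
    rw [norm_smul, norm_mul, Real.norm_eq_abs, Real.norm_eq_abs, abs_of_pos (one_half_pos (α := ℝ))]
    calc _ ≤ 1 / 2 * (C₂ * (C₁ * ‖v‖) * (C₁ * ‖v‖) * C₁) * C₁ := by
          gcongr
          refine hf.trans ?_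
          gcongr
      _ = _ := by ring
  have hsum := norm_sum_le_of_le Finset.univ fun i _ => hterm i
  have hcard : Fintype.card (Fin (Module.finrank ℝ (TangentSpace (𝓡 n) x))) = n := by
    rw [Fintype.card_fin]
    exact finrank_euclideanSpace_fin
  rw [Finset.sum_const, Finset.card_univ, hcard, nsmul_eq_mul] at hsum
  refine hsum.trans ?_
  rw [add_mul, one_mul, ← mul_assoc]
  exact le_add_of_nonneg_right (sq_nonneg _)

end Hessian

/-! ### Touching balls and barriers in Euclidean space -/

/-- Hopf's perturbation. Let `v ≤ M` be upper semicontinuous near `y`, with equality on the ball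
`closedBall z (dist y z)` only at its boundary point `y`, and let `h` vanish at `y` and be negative
outside that ball. For small `ε > 0` the function `v + ε h` is below `M` on a small sphere around
`y`, hence its maximum over the ball bounded by that sphere is attained inside: there `m - ε h`
touches `v` from above. -/
lemma exists_touching_perturbation {E : Type*} [MetricSpace E] [ProperSpace E]
    {v : E → EReal} {h : E → ℝ} {y z : E} {δ M : ℝ}
    (hδ : 0 < δ) (hv : UpperSemicontinuousOn v (Metric.closedBall y δ))
    (hvM : ∀ w ∈ Metric.closedBall y δ, v w ≤ M) (hvy : v y = M)
    (hlt : ∀ w ∈ Metric.closedBall y δ, dist w z ≤ dist y z → w ≠ y → v w < M)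
    (hh : Continuous h) (hhy : h y = 0) (hneg : ∀ w, dist y z < dist w z → h w < 0) :
    ∃ ε > 0, ∃ m : ℝ, ∃ w ∈ Metric.ball y δ, v w = ((m - ε * h w : ℝ) : EReal) ∧
      ∀ x ∈ Metric.closedBall y δ, v x ≤ ((m - ε * h x : ℝ) : EReal) := by
  have hyball : y ∈ Metric.closedBall y δ := Metric.mem_closedBall_self hδ.le
  have hAcomp : IsCompact (Metric.sphere y δ ∩ Metric.closedBall z (dist y z)) :=
    (isCompact_sphere y δ).inter_right Metric.isClosed_closedBall
  -- `v ≤ M' < M` on the part of the sphere where `h` may be positive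
  have hM' : ∃ M' : ℝ, M' < M ∧
      ∀ w ∈ Metric.sphere y δ ∩ Metric.closedBall z (dist y z), v w ≤ M' := by
    rcases (Metric.sphere y δ ∩ Metric.closedBall z (dist y z)).eq_empty_or_nonempty with h0 | h0
    · exact ⟨M - 1, by linarith, by simp [h0]⟩
    · obtain ⟨a, ha, hmax⟩ := (hv.mono (inter_subset_left.trans
        Metric.sphere_subset_closedBall)).exists_isMaxOn h0 hAcomp
      have haM : v a < M := hlt a (Metric.sphere_subset_closedBall ha.1) ha.2 (by
        rintro rfl
        have := ha.1
        rw [Metric.mem_sphere, dist_self] at this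
        exact hδ.ne this)
      obtain ⟨M', h1, h2⟩ := EReal.lt_iff_exists_real_btwn.1 haM
      exact ⟨M', by exact_mod_cast h2, fun w hw => (hmax hw).trans h1.le⟩
  obtain ⟨M', hM'M, hM'⟩ := hM'
  obtain ⟨B, hB⟩ := (isCompact_sphere y δ).exists_bound_of_continuousOn hh.continuousOn
  have hBpos : 0 < |B| + 1 := by positivity
  have hε : 0 < (M - M') / (2 * (|B| + 1)) := div_pos (by linarith) (by linarith)
  set ε := (M - M') / (2 * (|B| + 1)) with hεdef
  have hεB : ε * (2 * (|B| + 1)) = M - M' := div_mul_cancel₀ _ (by positivity)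
  have husc : UpperSemicontinuousOn (fun w => v w + ((ε * h w : ℝ) : EReal))
      (Metric.closedBall y δ) := by
    refine UpperSemicontinuousOn.add' hv
      ((continuous_coe_real_ereal.comp (hh.const_mul ε)).upperSemicontinuous.upperSemicontinuousOn
        _) ?_
    intro w hw
    exact EReal.continuousAt_add (Or.inr (EReal.coe_ne_bot _)) (Or.inr (EReal.coe_ne_top _))
  obtain ⟨w₀, hw₀, hmax⟩ := husc.exists_isMaxOn ⟨y, hyball⟩ (isCompact_closedBall y δ)
  have hge : (M : EReal) ≤ v w₀ + ((ε * h w₀ : ℝ) : EReal) := by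
    have := hmax hyball
    simpa [hhy, hvy] using this
  have hne_top : v w₀ ≠ ⊤ := ((hvM w₀ hw₀).trans_lt (EReal.coe_lt_top M)).ne
  have hne_bot : v w₀ ≠ ⊥ := by
    intro h0
    rw [h0, EReal.bot_add] at hge
    exact absurd hge (by simp)
  lift v w₀ to ℝ using ⟨hne_top, hne_bot⟩ with t ht
  have hge' : M ≤ t + ε * h w₀ := by exact_mod_cast hge
  have hle : ∀ x ∈ Metric.closedBall y δ, v x ≤ ((t + ε * h w₀ - ε * h x : ℝ) : EReal) := by
    intro x hx
    have h1 : v x + ((ε * h x : ℝ) : EReal) ≤ ((t + ε * h w₀ : ℝ) : EReal) := by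
      have := hmax hx
      simpa [← ht] using this
    rw [EReal.coe_sub]
    exact (EReal.le_sub_iff_add_le (Or.inl (EReal.coe_ne_bot _)) (Or.inl (EReal.coe_ne_top _))).2 h1
  refine ⟨ε, hε, t + ε * h w₀, w₀, ?_, ?_, hle⟩
  · by_contra hnot
    have hsph : w₀ ∈ Metric.sphere y δ := by
      rw [Metric.mem_ball, not_lt] at hnot
      exact le_antisymm hw₀ hnot
    by_cases hz : dist w₀ z ≤ dist y z
    · have h1 := hM' w₀ ⟨hsph, hz⟩
      rw [← ht] at h1
      have h1' : t ≤ M' := by exact_mod_cast h1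
      have h2 : h w₀ ≤ |B| := (le_abs_self _).trans ((hB w₀ hsph).trans (le_abs_self B))
      nlinarith
    · have h1 := hneg w₀ (not_le.1 hz)
      have h2 := hvM w₀ hw₀
      rw [← ht] at h2
      have h2' : t ≤ M := by exact_mod_cast h2
      nlinarith
  · rw [← ht, add_sub_cancel_right]

section Euclidean

variable {E : Type*} [NormedAddCommGroup E] [InnerProductSpace ℝ E]

/-- Interior sphere: if a set `S` is closed near one of its points `c` and misses a point near `c`,
then some closed ball near `c` meets `S` in exactly one point, which lies on its boundary. -/
lemma exists_closedBall_touching [ProperSpace E] {S : Set E} {a c : E} {r : ℝ}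
    (hS : IsClosed (S ∩ Metric.closedBall c r)) (hc : c ∈ S) (ha : a ∉ S)
    (hac : dist a c < r / 2) :
    ∃ y z : E, y ∈ S ∧ y ∈ Metric.ball c r ∧ y ≠ z ∧ ∀ w ∈ S, dist w z ≤ dist y z → w = y := by
  have hr : 0 < r := by linarith [dist_nonneg (x := a) (y := c)]
  have hcomp : IsCompact (S ∩ Metric.closedBall c r) :=
    (isCompact_closedBall c r).of_isClosed_subset hS inter_subset_right
  obtain ⟨y, hy, hmin⟩ := hcomp.exists_isMinOn ⟨c, hc, Metric.mem_closedBall_self hr.le⟩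
    (f := fun w => dist w a) (by fun_prop)
  have hya : dist y a ≤ dist c a := hmin ⟨hc, Metric.mem_closedBall_self hr.le⟩
  rw [dist_comm c a] at hya
  have hall : ∀ w ∈ S, dist y a ≤ dist w a := by
    intro w hw
    by_cases hwc : w ∈ Metric.closedBall c r
    · exact hmin ⟨hw, hwc⟩
    · rw [Metric.mem_closedBall, not_le] at hwc
      linarith [dist_triangle w a c]
  have hne : y ≠ a := fun h => ha (h ▸ hy.1)
  -- the ball around `a` through `y` may meet `S` in other boundary points; halving its radius
  -- while keeping it tangent at `y` removes them
  refine ⟨y, a + (1 / 2 : ℝ) • (y - a), hy.1, ?_, ?_, ?_⟩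
  · rw [Metric.mem_ball]
    linarith [dist_triangle y a c]
  · intro h
    have h2 : (1 / 2 : ℝ) • (y - a) = 0 := by
      have : y - a = (1 / 2 : ℝ) • (y - a) := by
        rw [sub_eq_iff_eq_add, add_comm]; exact h
      have h3 : (1 / 2 : ℝ) • (y - a) = (y - a) - (1 / 2 : ℝ) • (y - a) := by module
      rw [h3, sub_eq_zero]; exact this
    rw [smul_eq_zero] at h2
    rcases h2 with h2 | h2
    · norm_num at h2
    · exact hne (sub_eq_zero.1 h2)
  · intro w hw hwz
    have h1 := hall w hw
    rw [dist_eq_norm, dist_eq_norm] at h1 hwz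
    set s := y - a
    have hw' : w - (a + (1 / 2 : ℝ) • s) = (w - a) - (1 / 2 : ℝ) • s := by module
    have hy' : y - (a + (1 / 2 : ℝ) • s) = s - (1 / 2 : ℝ) • s := by simp only [s]; module
    rw [hw', hy'] at hwz
    have e1 := norm_sub_sq_real (w - a) ((1 / 2 : ℝ) • s)
    have e2 := norm_sub_sq_real s ((1 / 2 : ℝ) • s)
    have e3 := norm_sub_sq_real (w - a) s
    rw [inner_smul_right] at e1 e2
    rw [real_inner_self_eq_norm_sq] at e2
    have h4 := pow_le_pow_left₀ (norm_nonneg _) hwz 2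
    have h5 := pow_le_pow_left₀ (norm_nonneg _) h1 2
    have h6 : ‖(w - a) - s‖ ^ 2 ≤ 0 := by nlinarith
    have h7 : (w - a) - s = 0 := by
      rw [← norm_eq_zero]; exact pow_eq_zero_iff two_ne_zero |>.1 (le_antisymm h6 (sq_nonneg _))
    have h8 : w - y = 0 := by rw [← h7]; simp only [s]; abel
    exact sub_eq_zero.1 h8

/-- The derivative of the barrier `k - ε exp (-α ‖w - z‖²)`. -/
lemma hasFDerivAt_gaussian (k ε α : ℝ) (z w : E) :
    HasFDerivAt (fun w => k - ε * Real.exp (-α * ‖w - z‖ ^ 2))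
      ((2 * ε * α * Real.exp (-α * ‖w - z‖ ^ 2)) • innerSL ℝ (w - z)) w := by
  have h1 : HasFDerivAt (fun w : E => ‖w - z‖ ^ 2) (2 • innerSL ℝ (w - z)) w := by
    simpa using ((hasFDerivAt_id w).sub_const z).norm_sq
  have h2 := (((h1.const_mul (-α)).exp).const_mul ε).const_sub k
  refine h2.congr_fderiv ?_
  ext a
  simp
  ring

lemma fderiv_gaussian (k ε α : ℝ) (z w : E) :
    fderiv ℝ (fun w => k - ε * Real.exp (-α * ‖w - z‖ ^ 2)) w =
      (2 * ε * α * Real.exp (-α * ‖w - z‖ ^ 2)) • innerSL ℝ (w - z) :=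
  (hasFDerivAt_gaussian k ε α z w).fderiv

lemma fderiv_fderiv_gaussian_apply (k ε α : ℝ) (z w a : E) :
    fderiv ℝ (fderiv ℝ (fun w => k - ε * Real.exp (-α * ‖w - z‖ ^ 2))) w a a =
      2 * ε * α * Real.exp (-α * ‖w - z‖ ^ 2) * (‖a‖ ^ 2 - 2 * α * inner ℝ (w - z) a ^ 2) := by
  have h1 : HasFDerivAt (fun w : E => 2 * ε * α * Real.exp (-α * ‖w - z‖ ^ 2))
      ((-2 * α * (2 * ε * α * Real.exp (-α * ‖w - z‖ ^ 2))) • innerSL ℝ (w - z)) w := by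
    have h := (hasFDerivAt_gaussian 0 (-(2 * ε * α)) α z w)
    simp only [zero_sub, neg_mul, neg_neg] at h ⊢
    exact h.congr_fderiv (by congr 1; ring)
  have h2 : HasFDerivAt (fun w : E => innerSL ℝ (w - z)) (innerSL ℝ) w := by
    have := (innerSL ℝ (E := E)).hasFDerivAt.comp w ((hasFDerivAt_id w).sub_const z)
    exact this.congr_fderiv (by ext; simp)
  have h3 : fderiv ℝ (fun w => k - ε * Real.exp (-α * ‖w - z‖ ^ 2)) =
      fun w => (2 * ε * α * Real.exp (-α * ‖w - z‖ ^ 2)) • innerSL ℝ (w - z) :=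
    funext fun w => fderiv_gaussian k ε α z w
  have h4 : innerSL ℝ a a = ‖a‖ ^ 2 := real_inner_self_eq_norm_sq a
  rw [h3, (h1.fun_smul h2).fderiv]
  simp only [_root_.add_apply, _root_.smul_apply, ContinuousLinearMap.smulRight_apply,
    innerSL_apply_apply, smul_eq_mul, h4]
  ring

end Euclidean

/-! ### The trace of the Hessian of the barrier -/

section Trace

variable {V : Type*} [NormedAddCommGroup V] [InnerProductSpace ℝ V] [FiniteDimensional ℝ V]

/-- For a linear form `l` the sum `∑ l(bᵢ)²` over an orthonormal basis of `W` is the squared norm of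
`l` on `W`, hence is bounded below by testing `l` on a single vector of `W`. -/
lemma sq_le_norm_sq_mul_sum_stdOrthonormalBasis (W : Submodule ℝ V) (l : V →ₗ[ℝ] ℝ) (t : W) :
    l t ^ 2 ≤ ‖t‖ ^ 2 * ∑ i, l (stdOrthonormalBasis ℝ W i) ^ 2 := by
  set b := stdOrthonormalBasis ℝ W
  have h1 : l t = ∑ i, b.repr t i * l (b i) := by
    conv_lhs => rw [← b.sum_repr t]
    simp
  have h2 : ‖t‖ ^ 2 = ∑ i, b.repr t i ^ 2 := by
    rw [← b.sum_sq_norm_inner_right t]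
    simp [b.repr_apply_apply]
  rw [h1, h2]
  exact Finset.sum_mul_sq_le_sq_mul_sq _ _ _

lemma traceOn_le {p : ℕ} {W : Submodule ℝ V} (hW : Module.finrank ℝ W = p) {A : V → V → ℝ}
    {l : V → ℝ} {c d : ℝ} (h : ∀ v, A v v ≤ c * ‖v‖ ^ 2 - d * l v ^ 2) :
    traceOn W A ≤ p * c - d * ∑ i, l (stdOrthonormalBasis ℝ W i) ^ 2 := by
  subst hW
  have h1 : ∀ i, A (stdOrthonormalBasis ℝ W i) (stdOrthonormalBasis ℝ W i) ≤
      c - d * l (stdOrthonormalBasis ℝ W i) ^ 2 := by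
    intro i
    have h2 := h (stdOrthonormalBasis ℝ W i)
    have h3 : ‖((stdOrthonormalBasis ℝ W i : W) : V)‖ = 1 :=
      (stdOrthonormalBasis ℝ W).norm_eq_one i
    rwa [h3, one_pow, mul_one] at h2
  refine (Finset.sum_le_sum fun i _ => h1 i).trans_eq ?_
  rw [Finset.sum_sub_distrib, ← Finset.mul_sum, Finset.sum_const, Finset.card_univ,
    Fintype.card_fin, nsmul_eq_mul]

end Trace

section Barrier

variable {n p : ℕ} {X : Type*} [TopologicalSpace X] [ChartedSpace (EuclideanSpace ℝ (Fin n)) X]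
  [IsManifold (𝓡 n) ∞ X]

lemma contMDiffAt_gaussian_extChartAt {q x : X}
    (hx : x ∈ (chartAt (EuclideanSpace ℝ (Fin n)) q).source) (k ε α : ℝ)
    (z : EuclideanSpace ℝ (Fin n)) :
    ContMDiffAt (𝓡 n) 𝓘(ℝ) 2
      (fun y => k - ε * Real.exp (-α * ‖extChartAt (𝓡 n) q y - z‖ ^ 2)) x := by
  have h1 : ContDiff ℝ 2 fun w : EuclideanSpace ℝ (Fin n) =>
      k - ε * Real.exp (-α * ‖w - z‖ ^ 2) :=
    contDiff_const.sub (contDiff_const.mul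
      (contDiff_const.mul ((contDiff_id.sub contDiff_const).norm_sq ℝ)).exp)
  have h2 : ContMDiffAt (𝓡 n) 𝓘(ℝ, EuclideanSpace ℝ (Fin n)) 2 (extChartAt (𝓡 n) q) x :=
    (contMDiffAt_extChartAt' (I := 𝓡 n) (n := ∞) hx).of_le (by norm_cast)
  exact h1.contDiffAt.contMDiffAt.comp x h2

variable [RiemannianBundle (fun x : X => TangentSpace (𝓡 n) x)]

/-- For a continuous section `S` of planes, the projections onto `S x` of the vectors with fixed
components in the preferred chart at `q` have continuous components. -/
lemma continuousAt_tcoord_starProjection {q y : X}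
    (hy : y ∈ (chartAt (EuclideanSpace ℝ (Fin n)) q).source)
    {S : ∀ x : X, Grassmannian p (TangentSpace (𝓡 n) x)}
    (hS : ContinuousAt (fun x : X => planeProj (⟨x, S x⟩ : GrassmannBundle n p X)) y)
    (a : EuclideanSpace ℝ (Fin n)) :
    ContinuousAt (fun x => tcoord q x ((S x).1.starProjection (tvec q x a))) y := by
  let τ := trivializationAt (EuclideanSpace ℝ (Fin n) →L[ℝ] EuclideanSpace ℝ (Fin n))
    (fun x : X => TangentSpace (𝓡 n) x →L[ℝ] TangentSpace (𝓡 n) x) q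
  have h1 : ContinuousAt (fun x : X => (τ (planeProj (⟨x, S x⟩ : GrassmannBundle n p X))).2) y := by
    refine continuousAt_snd.comp (ContinuousAt.comp (g := τ) ?_ hS)
    refine τ.continuousAt ?_
    rw [Trivialization.mem_source]
    simpa [τ, planeProj] using hy
  exact h1.clm_apply continuousAt_const

variable [IsContMDiffRiemannianBundle (𝓡 n) ∞ (EuclideanSpace ℝ (Fin n))
      (fun x : X => TangentSpace (𝓡 n) x)]

/-- If the Euclidean radial direction from `z` is not orthogonal to `S y` at `y`, then this remains
true, with a uniform lower bound, for `S x` with `x` near `y`. Here `w` is a witness at `y`, and the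
projections onto `S x` of the vectors with the same components are witnesses at `x`. -/
lemma exists_eventually_le_sum_sq {q y : X}
    (hy : y ∈ (chartAt (EuclideanSpace ℝ (Fin n)) q).source)
    {S : ∀ x : X, Grassmannian p (TangentSpace (𝓡 n) x)}
    (hS : ContinuousAt (fun x : X => planeProj (⟨x, S x⟩ : GrassmannBundle n p X)) y)
    {w : TangentSpace (𝓡 n) y} (hw : w ∈ (S y).1) {z : EuclideanSpace ℝ (Fin n)}
    (hne : inner ℝ (extChartAt (𝓡 n) q y - z) (tcoord q y w) ≠ 0) :
    ∃ κ > 0, ∀ᶠ x in 𝓝 y, κ ≤ ∑ i, inner ℝ (extChartAt (𝓡 n) q x - z)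
      (tcoord q x (stdOrthonormalBasis ℝ (S x).1 i : TangentSpace (𝓡 n) x)) ^ 2 := by
  set a := tcoord q y w with ha
  have hec : ContinuousAt (extChartAt (𝓡 n) q) y :=
    continuousAt_extChartAt' (I := 𝓡 n) (by simpa using hy)
  have hc := continuousAt_tcoord_starProjection hy hS a
  have hf : ContinuousAt (fun x => inner ℝ (extChartAt (𝓡 n) q x - z)
      (tcoord q x ((S x).1.starProjection (tvec q x a))) ^ 2) y :=
    ((hec.sub continuousAt_const).inner hc).pow 2
  have hfy : 0 < inner ℝ (extChartAt (𝓡 n) q y - z)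
      (tcoord q y ((S y).1.starProjection (tvec q y a))) ^ 2 := by
    rw [ha, tvec_tcoord hy, Submodule.starProjection_eq_self_iff.2 hw]
    positivity
  have hG : ContinuousAt (fun x => chartMetric q (extChartAt (𝓡 n) q x) a a) y := by
    have h1 : ContinuousAt (chartMetric q) (extChartAt (𝓡 n) q y) :=
      (contDiffOn_chartMetric q).continuousOn.continuousAt
        ((isOpen_extChartAt_target (I := 𝓡 n) q).mem_nhds
          ((extChartAt (𝓡 n) q).map_source (by simpa using hy)))
    exact ((h1.comp hec).clm_apply continuousAt_const).clm_apply continuousAt_const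
  have hN : 0 < |chartMetric q (extChartAt (𝓡 n) q y) a a| + 1 := by positivity
  refine ⟨_, div_pos (half_pos hfy) hN, ?_⟩
  filter_upwards [hf.eventually_const_lt (half_lt_self hfy),
    hG.eventually_lt_const ((le_abs_self _).trans_lt (lt_add_one _)),
    (chartAt (EuclideanSpace ℝ (Fin n)) q).open_source.mem_nhds hy] with x h1 h2 hx
  rw [div_le_iff₀ hN]
  refine h1.le.trans ?_
  have h3 := sq_le_norm_sq_mul_sum_stdOrthonormalBasis (S x).1
    (((innerSL ℝ (extChartAt (𝓡 n) q x - z)).toLinearMap) ∘ₗ (tcoord q x).toLinearMap)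
    ⟨(S x).1.starProjection (tvec q x a), Submodule.starProjection_apply_mem _ _⟩
  have h4 : ‖(S x).1.starProjection (tvec q x a)‖ ^ 2
      ≤ |chartMetric q (extChartAt (𝓡 n) q y) a a| + 1 := by
    have h5 : ‖tvec q x a‖ ^ 2 = chartMetric q (extChartAt (𝓡 n) q x) a a := by
      rw [← real_inner_self_eq_norm_sq, ← chartMetric_extChartAt hx, tcoord_tvec hx]
    have h6 := Submodule.norm_starProjection_apply_le (S x).1 (tvec q x a)
    calc _ ≤ ‖tvec q x a‖ ^ 2 := by gcongr
      _ ≤ _ := h5 ▸ h2.le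
  refine h3.trans ?_
  rw [mul_comm]
  exact mul_le_mul_of_nonneg_left h4 (Finset.sum_nonneg fun i _ => sq_nonneg _)

/-- The Hessian of the barrier: for large `α` the negative term, which carries the extra factor
`2 * α`, dominates in the directions not orthogonal to the radial one. -/
lemma riemHess_gaussian_le {q x : X} (hx : x ∈ (chartAt (EuclideanSpace ℝ (Fin n)) q).source)
    {k ε α C₁ C₂ : ℝ} (hε : 0 < ε) (hα : 0 < α) {z : EuclideanSpace ℝ (Fin n)}
    (v : TangentSpace (𝓡 n) x)
    (h₁ : ‖tcoord q x v‖ ≤ C₁ * ‖v‖) (h₂ : ‖christoffelVec q x v v‖ ≤ C₂ * ‖v‖ ^ 2) :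
    riemHess (fun y => k - ε * Real.exp (-α * ‖extChartAt (𝓡 n) q y - z‖ ^ 2)) x v v ≤
      2 * ε * α * Real.exp (-α * ‖extChartAt (𝓡 n) q x - z‖ ^ 2) *
        (C₁ ^ 2 + ‖extChartAt (𝓡 n) q x - z‖ * C₂) * ‖v‖ ^ 2 -
      2 * ε * α * Real.exp (-α * ‖extChartAt (𝓡 n) q x - z‖ ^ 2) * (2 * α) *
        inner ℝ (extChartAt (𝓡 n) q x - z) (tcoord q x v) ^ 2 := by
  set φ : X → ℝ := fun y => k - ε * Real.exp (-α * ‖extChartAt (𝓡 n) q y - z‖ ^ 2) with hφ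
  have hev : φ ∘ (extChartAt (𝓡 n) q).symm =ᶠ[𝓝 (extChartAt (𝓡 n) q x)]
      fun w => k - ε * Real.exp (-α * ‖w - z‖ ^ 2) := by
    filter_upwards [(isOpen_extChartAt_target (I := 𝓡 n) q).mem_nhds
      ((extChartAt (𝓡 n) q).map_source (x := x) (by simpa using hx))] with w hw
    simp only [hφ, Function.comp_apply, (extChartAt (𝓡 n) q).right_inv hw]
  rw [riemHess_eq hx (contMDiffAt_gaussian_extChartAt hx k ε α z), hev.fderiv.fderiv_eq,
    hev.fderiv_eq, fderiv_fderiv_gaussian_apply, fderiv_gaussian, _root_.smul_apply,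
    innerSL_apply_apply, smul_eq_mul]
  set w := extChartAt (𝓡 n) q x - z
  have hpos : 0 ≤ 2 * ε * α * Real.exp (-α * ‖w‖ ^ 2) := by positivity
  have h3 : ‖tcoord q x v‖ ^ 2 ≤ C₁ ^ 2 * ‖v‖ ^ 2 := by
    rw [← mul_pow]; gcongr
  have h4 : -inner ℝ w (christoffelVec q x v v) ≤ ‖w‖ * (C₂ * ‖v‖ ^ 2) :=
    ((neg_le_abs _).trans (abs_real_inner_le_norm _ _)).trans (by gcongr)
  nlinarith [mul_le_mul_of_nonneg_left (add_le_add h3 h4) hpos]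

end Barrier

/-! ### Propagation of maxima and the strong maximum principle -/

section Propagation

variable {n p : ℕ} {X : Type*} [TopologicalSpace X] [ChartedSpace (EuclideanSpace ℝ (Fin n)) X]
  [IsManifold (𝓡 n) ∞ X] [RiemannianBundle (fun x : X => TangentSpace (𝓡 n) x)]
  {𝔾 : Set (GrassmannBundle n p X)}

/-- Since `𝔾` involves all the variables, no nonzero covector annihilates all planes of `𝔾` over a
point: apply the definition to the vector representing the covector. -/
lemma InvolvesAllVariables.exists_inner_tcoord_ne_zero (h : InvolvesAllVariables 𝔾) {q y : X}
    (hy : y ∈ (chartAt (EuclideanSpace ℝ (Fin n)) q).source) {a : EuclideanSpace ℝ (Fin n)}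
    (ha : a ≠ 0) : ∃ W ∈ gFiber 𝔾 y, ∃ w ∈ W.1, inner ℝ a (tcoord q y w) ≠ 0 := by
  by_contra! hcon
  have : CompleteSpace (TangentSpace (𝓡 n) y) := FiniteDimensional.complete ℝ _
  set ν : TangentSpace (𝓡 n) y :=
    (InnerProductSpace.toDual ℝ (TangentSpace (𝓡 n) y)).symm ((innerSL ℝ a).comp (tcoord q y))
  have hν : ∀ w : TangentSpace (𝓡 n) y, inner ℝ ν w = inner ℝ a (tcoord q y w) := fun w => by
    rw [InnerProductSpace.toDual_symm_apply]; rfl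
  have h0 : ν = 0 := h y ν fun W hW => by
    rw [Submodule.mem_orthogonal']
    intro w hw
    rw [hν]
    exact hcon W hW w hw
  have h1 := hν (tvec q y a)
  rw [h0, inner_zero_left, tcoord_tvec hy] at h1
  exact ha (inner_self_eq_zero.1 h1.symm)

variable [IsContMDiffRiemannianBundle (𝓡 n) ∞ (EuclideanSpace ℝ (Fin n))
      (fun x : X => TangentSpace (𝓡 n) x)]

/-- The barrier cannot touch a `𝔾`-plurisubharmonic function from above at a point where some plane
of `𝔾` is far from orthogonal to the radial direction, once `α` is large compared with the local
bounds `C₁`, `C₂`, `D` of the geometry. -/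
lemma IsPSHOn.not_exists_barrier {u : X → EReal} {K : Set X} (hu : IsPSHOn 𝔾 u K)
    {q x : X} (hx : x ∈ (chartAt (EuclideanSpace ℝ (Fin n)) q).source) (hxK : x ∈ interior K)
    {C₁ C₂ D κ k ε α : ℝ} (hε : 0 < ε) (hα : 0 < α) {z : EuclideanSpace ℝ (Fin n)}
    (h₁ : ∀ v : TangentSpace (𝓡 n) x, ‖tcoord q x v‖ ≤ C₁ * ‖v‖)
    (h₂ : ∀ v : TangentSpace (𝓡 n) x, ‖christoffelVec q x v v‖ ≤ C₂ * ‖v‖ ^ 2)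
    (hC₂ : 0 ≤ C₂)
    (hD : ‖extChartAt (𝓡 n) q x - z‖ ≤ D) {W : Grassmannian p (TangentSpace (𝓡 n) x)}
    (hW : W ∈ gFiber 𝔾 x)
    (hκ : κ ≤ ∑ i, inner ℝ (extChartAt (𝓡 n) q x - z)
      (tcoord q x (stdOrthonormalBasis ℝ W.1 i : TangentSpace (𝓡 n) x)) ^ 2)
    (hακ : p * (C₁ ^ 2 + D * C₂) < 2 * α * κ)
    (htest : ∀ᶠ y in 𝓝 x, u y ≤
      ((k - ε * Real.exp (-α * ‖extChartAt (𝓡 n) q y - z‖ ^ 2) : ℝ) : EReal))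
    (heq : u x = ((k - ε * Real.exp (-α * ‖extChartAt (𝓡 n) q x - z‖ ^ 2) : ℝ) : EReal)) :
    False := by
  have h := hu.trace_nonneg x hxK _ ⟨contMDiffAt_gaussian_extChartAt hx k ε α z, htest, heq⟩ W hW
  have h3 := h.trans (traceOn_le W.2 fun v =>
    riemHess_gaussian_le (k := k) hx hε hα v (h₁ v) (h₂ v))
  set E := 2 * ε * α * Real.exp (-α * ‖extChartAt (𝓡 n) q x - z‖ ^ 2)
  have hE : 0 < E := by positivity
  set Q := ∑ i, inner ℝ (extChartAt (𝓡 n) q x - z)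
      (tcoord q x (stdOrthonormalBasis ℝ W.1 i : TangentSpace (𝓡 n) x)) ^ 2
  have h4 : p * (C₁ ^ 2 + ‖extChartAt (𝓡 n) q x - z‖ * C₂) ≤ p * (C₁ ^ 2 + D * C₂) := by gcongr
  have h5 : 2 * α * κ ≤ 2 * α * Q := by gcongr
  have h6 : 0 ≤ E * (p * (C₁ ^ 2 + ‖extChartAt (𝓡 n) q x - z‖ * C₂) - 2 * α * Q) := by
    linarith
  have h7 := nonneg_of_mul_nonneg_right h6 hE
  linarith

/-- Propagation of interior maxima: the set where a `𝔾`-plurisubharmonic function attains its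
maximum is open. -/
lemma IsPSHOn.eventually_eq_of_isMaxOn {u : X → EReal} {K : Set X} (hu : IsPSHOn 𝔾 u K)
    (h_regular : IsRegularPlaneSet 𝔾) (h_vars : InvolvesAllVariables 𝔾)
    {M : ℝ} (hM : ∀ y ∈ K, u y ≤ M) {q : X} (hq : q ∈ interior K) (hqM : u q = M) :
    ∀ᶠ x in 𝓝 q, u x = M := by
  by_contra hnot
  obtain ⟨C₁, hC₁, h₁⟩ := exists_eventually_norm_tcoord_le (n := n) q
  obtain ⟨C₂, hC₂, h₂⟩ := exists_eventually_norm_christoffelVec_le (n := n) q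
  set e := extChartAt (𝓡 n) q with he
  have hsymm : ContinuousOn e.symm e.target := continuousOn_extChartAt_symm q
  have hqt : e q ∈ e.target := mem_extChartAt_target q
  -- a ball in the chart on which all the bounds hold; the rest of the argument stays inside it
  have hgood : ∀ᶠ w in 𝓝 (e q), w ∈ e.target ∧ e.symm w ∈ interior K ∧
      (∀ v : TangentSpace (𝓡 n) (e.symm w), ‖tcoord q (e.symm w) v‖ ≤ C₁ * ‖v‖) ∧
      (∀ v : TangentSpace (𝓡 n) (e.symm w),
        ‖christoffelVec q (e.symm w) v v‖ ≤ C₂ * ‖v‖ ^ 2) := by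
    have ht : e.target ∈ 𝓝 (e q) := (isOpen_extChartAt_target q).mem_nhds hqt
    have hc : Tendsto e.symm (𝓝 (e q)) (𝓝 q) := continuousAt_extChartAt_symm q |>.tendsto.mono_right
      (by rw [extChartAt_to_inv])
    filter_upwards [ht, hc.eventually (isOpen_interior.mem_nhds hq), hc.eventually h₁,
      hc.eventually h₂] with w a b c d using ⟨a, b, c, d⟩
  obtain ⟨r, hr, hball⟩ := Metric.nhds_basis_closedBall.eventually_iff.1 hgood
  set v : EuclideanSpace ℝ (Fin n) → EReal := fun w => u (e.symm w) with hv
  have husc : UpperSemicontinuousOn v (Metric.closedBall (e q) r) :=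
    UpperSemicontinuousOn.comp hu.usc (hsymm.mono fun w hw => (hball hw).1)
      fun w hw => interior_subset (hball hw).2.1
  have hvM : ∀ w ∈ Metric.closedBall (e q) r, v w ≤ M := fun w hw =>
    hM _ (interior_subset (hball hw).2.1)
  have hclosed : IsClosed ({w | v w = M} ∩ Metric.closedBall (e q) r) := by
    obtain ⟨T, hT, hTe⟩ := upperSemicontinuousOn_iff_preimage_Ici.1 husc M
    have : {w | v w = M} ∩ Metric.closedBall (e q) r = Metric.closedBall (e q) r ∩ T := by
      rw [← hTe]
      ext w
      constructor
      · rintro ⟨h, hw⟩; exact ⟨hw, h.ge⟩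
      · rintro ⟨hw, h⟩; exact ⟨le_antisymm (hvM w hw) h, hw⟩
    rw [this]
    exact Metric.isClosed_closedBall.inter hT
  obtain ⟨a, hav, haq⟩ : ∃ a, v a ≠ M ∧ dist a (e q) < r / 2 := by
    have h1 : ∀ᶠ x in 𝓝 q, dist (e x) (e q) < r / 2 :=
      (continuousAt_extChartAt (I := 𝓡 n) q).eventually (Metric.ball_mem_nhds _ (half_pos hr))
    obtain ⟨x, hx1, hx2, hx3⟩ :=
      ((not_eventually.1 hnot).and_eventually
        (h1.and (extChartAt_source_mem_nhds (I := 𝓡 n) q))).exists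
    refine ⟨e x, ?_, hx2⟩
    simpa only [hv, e.left_inv hx3] using hx1
  obtain ⟨y, z, hyS, hyball, hyz, htouch⟩ := exists_closedBall_touching hclosed
    (by simpa only [hv, mem_ofPred_eq, he, extChartAt_to_inv] using hqM) hav haq
  have hyg := hball (Metric.ball_subset_closedBall hyball)
  have hsource : ∀ w ∈ e.target, e.symm w ∈ (chartAt (EuclideanSpace ℝ (Fin n)) q).source :=
    fun w hw => by simpa [he] using e.map_target hw
  obtain ⟨W, hW, w₀, hw₀, hne⟩ := h_vars.exists_inner_tcoord_ne_zero (hsource y hyg.1)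
    (sub_ne_zero.2 hyz)
  obtain ⟨U, S, hU, hyU, rfl, hSG, hSsmooth⟩ := h_regular _ W hW
  obtain ⟨κ, hκ, hev⟩ := exists_eventually_le_sum_sq (hsource y hyg.1)
    (hSsmooth.continuousOn.continuousAt (hU.mem_nhds hyU)) hw₀ (z := z)
    (by rwa [← he, e.right_inv hyg.1])
  have hsy : ContinuousAt e.symm y :=
    hsymm.continuousAt ((isOpen_extChartAt_target q).mem_nhds hyg.1)
  obtain ⟨δ, hδ, hδball⟩ := Metric.nhds_basis_closedBall.eventually_iff.1
    ((hsy.eventually (hev.and (hU.mem_nhds hyU))).and (Metric.isOpen_ball.mem_nhds hyball))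
  set D := ‖y - z‖ + δ with hD
  set α := (p * (C₁ ^ 2 + D * C₂) + 1) / (2 * κ) with hα
  have hαpos : 0 < α := by positivity
  have hακ : p * (C₁ ^ 2 + D * C₂) < 2 * α * κ := by
    have : 2 * α * κ = p * (C₁ ^ 2 + D * C₂) + 1 := by rw [hα]; field_simp
    linarith
  have hsub : Metric.closedBall y δ ⊆ Metric.closedBall (e q) r := fun w hw =>
    Metric.ball_subset_closedBall (hδball hw).2
  -- the touching point `w` depends on `α`, but all bounds were fixed before `α`
  obtain ⟨ε, hε, m, w, hw, hweq, hwle⟩ := exists_touching_perturbation (z := z)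
    (h := fun w => Real.exp (-α * ‖w - z‖ ^ 2) - Real.exp (-α * ‖y - z‖ ^ 2)) hδ (husc.mono hsub)
    (fun w hw => hvM w (hsub hw)) hyS
    (fun w hw hwz hwy => lt_of_le_of_ne (hvM w (hsub hw)) fun h => hwy (htouch w h hwz))
    (by fun_prop) (by simp) (fun w hw => by
      rw [dist_eq_norm, dist_eq_norm] at hw
      rw [sub_neg, Real.exp_lt_exp]
      have := pow_lt_pow_left₀ hw (norm_nonneg _) two_ne_zero
      nlinarith)
  have hwcb := Metric.ball_subset_closedBall hw
  have hwg := hball (hsub hwcb)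
  have hexp : ∀ t : ℝ, m - ε * (Real.exp t - Real.exp (-α * ‖y - z‖ ^ 2)) =
      (m + ε * Real.exp (-α * ‖y - z‖ ^ 2)) - ε * Real.exp t := fun t => by ring
  have hew := e.right_inv hwg.1
  refine hu.not_exists_barrier (hsource w hwg.1) hwg.2.1 (z := z) (D := D)
    (k := m + ε * Real.exp (-α * ‖y - z‖ ^ 2)) hε hαpos hwg.2.2.1 hwg.2.2.2 hC₂.le ?_
    (hSG _ (hδball hwcb).1.2) (hδball hwcb).1.1 hακ ?_ ?_
  · rw [← he, hew, hD]
    have h1 := norm_sub_le_norm_sub_add_norm_sub w y z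
    have h2 := Metric.mem_closedBall.1 hwcb
    rw [dist_eq_norm] at h2
    linarith
  · have hmem : e.symm w ∈ e.source := e.map_target hwg.1
    have hcw : ContinuousAt e (e.symm w) := continuousAt_extChartAt' hmem
    rw [ContinuousAt, hew] at hcw
    filter_upwards [hcw.eventually (Metric.isOpen_ball.mem_nhds hw),
      (isOpen_extChartAt_source q).mem_nhds hmem] with x hx1 hx2
    have := hwle (e x) (Metric.ball_subset_closedBall hx1)
    rw [hexp] at this
    simpa only [hv, e.left_inv hx2] using this
  · rw [hexp] at hweq
    rw [← he, hew]
    exact hweq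

end Propagation

theorem theorem8p5 {n p : ℕ} (hp : 1 ≤ p) (hpn : p ≤ n)
    {X : Type*} [TopologicalSpace X] [T2Space X] [SecondCountableTopology X]
    [ChartedSpace (EuclideanSpace ℝ (Fin n)) X] [IsManifold (𝓡 n) ∞ X]
    [RiemannianBundle (fun x : X => TangentSpace (𝓡 n) x)]
    [IsContMDiffRiemannianBundle (𝓡 n) ∞ (EuclideanSpace ℝ (Fin n))
      (fun x : X => TangentSpace (𝓡 n) x)]
    (𝔾 : Set (GrassmannBundle n p X)) (h_closed : IsClosed 𝔾)
    (h_regular : IsRegularPlaneSet 𝔾) (h_vars : InvolvesAllVariables 𝔾)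
    (K : Set X) (hK : IsCompact K) (hK_conn : IsConnected (interior K))
    (hK_reg : K = closure (interior K))
    (u : X → EReal) (hu : IsPSHOn 𝔾 u K)
    (x₀ : X) (hx₀ : x₀ ∈ interior K) (hmax : ∀ y ∈ K, u y ≤ u x₀) :
    ∃ c : EReal, ∀ x ∈ K, u x = c := by
  refine ⟨u x₀, ?_⟩
  have htop := hu.lt_top x₀ (interior_subset hx₀)
  rcases eq_or_ne (u x₀) ⊥ with hbot | hbot
  · exact fun x hx => le_antisymm (hmax x hx) (hbot ▸ bot_le)
  lift u x₀ to ℝ using ⟨htop.ne, hbot⟩ with M hM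
  -- `u < M` is an open condition on `interior K` by semicontinuity, `u = M` by propagation
  have hint : ∀ x ∈ interior K, u x = M := by
    have hopen₁ : IsOpen (interior K ∩ {x | u x = M}) := by
      rw [isOpen_iff_mem_nhds]
      rintro x ⟨hx, hxM⟩
      exact inter_mem (isOpen_interior.mem_nhds hx)
        (hu.eventually_eq_of_isMaxOn h_regular h_vars hmax hx hxM)
    have hopen₂ : IsOpen (interior K ∩ {x | u x < M}) := by
      rw [isOpen_iff_mem_nhds]
      rintro x ⟨hx, hxM⟩
      have h1 := hu.usc x (interior_subset hx) M hxM
      rw [nhdsWithin_eq_nhds.2 (mem_interior_iff_mem_nhds.1 hx)] at h1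
      exact inter_mem (isOpen_interior.mem_nhds hx) h1
    have hsub := hK_conn.isPreconnected.subset_left_of_subset_union hopen₁ hopen₂
      (disjoint_left.2 fun x h1 h2 => h2.2.ne h1.2)
      (fun x hx => (hmax x (interior_subset hx)).eq_or_lt.imp (fun h => ⟨hx, h⟩) fun h => ⟨hx, h⟩)
      ⟨x₀, hx₀, hx₀, hM.symm⟩
    exact fun x hx => (hsub hx).2
  intro x hx
  refine le_antisymm (hmax x hx) (not_lt.1 fun hlt => ?_)
  -- a value below `M` at a boundary point would persist at nearby interior points
  have h1 := hu.usc x hx M hlt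
  have h2 : (𝓝[interior K] x).NeBot := mem_closure_iff_nhdsWithin_neBot.1 (hK_reg ▸ hx)
  obtain ⟨y, hy1, hy2⟩ :=
    ((h1.filter_mono (nhdsWithin_mono x interior_subset)).and self_mem_nhdsWithin).exists
  exact hy1.ne (hint y hy2)
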